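/- For $n\in\mathbb{N}$ let $\mathcal{K}^n$ be the family of all compact convex subsets of $\mathbb{R}^n$ and let $\mathcal{K}^n_n$ be the family of those with non-empty interior. For $j\in\{1,\dots,n\}$ let $G_{n,j}$ be the Grassmannian of $j$-dimensional linear subspaces of $\mathbb{R}^n$, with its Haar (rotation invariant) probability measure $\sigma_{n,j}$, and let $$V_j(K)=\binom{n}{j}\frac{\kappa_n}{\kappa_j\,\kappa_{n-j}}\int_{G_{n,j}}\mathrm{vol}_E(K|E)\,d\sigma_{n,j}(E),\qquad K\in\mathcal{K}^n,$$ be the $j$-th intrinsic volume, where $K|E$ is the orthogonal projection of $K$ onto $E$, $\mathrm{vol}_E$ is the $j$-dimensional Lebesgue measure on $E$, and $\kappa_m$ is the volume of the Euclidean unit ball in $\mathbb{R}^m$. For a linear subspace $H$ of $\mathbb{R}^n$, a set is called $H$-symmetric if it equals its reflection with respect to $H$, i.e. its image under $x\mapsto 2(x|H)-x$. For a family $\mathcal{B}$ of sets, let $\mathcal{B}_H$ be the family of $H$-symmetric members of $\mathcal{B}$. **Theorem 4.1.** Let $i\in\{0,\dots,n-1\}$ and $j\in\{2,\dots,n\}$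 with $j\le n-i$, let $H\subseteq\mathbb{R}^n$ be a linear subspace of dimension $i$, and let $\mathcal{B}$ be $\mathcal{K}^n$ or $\mathcal{K}^n_n$. Then there is no map $\diamondsuit:\mathcal{B}\to\mathcal{B}_H$ that has all of the following properties: 1. (monotonic) $\diamondsuit K\subseteq\diamondsuit L$ for all $K,L\in\mathcal{B}$ with $K\subseteq L$; 2. (invariant on $H$-symmetric sets) $\diamondsuit K=K$ for all $K\in\mathcal{B}_H$; 3. ($V_j$-preserving) $V_j(\diamondsuit K)=V_j(K)$ for all $K\in\mathcal{B}$. -/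

import Mathlib

open MeasureTheory
open scoped ENNReal

/-- The coordinate subspace of `ℝⁿ` spanned by the first `j` vectors of the standard basis. -/
noncomputable def coordSubspace (n j : ℕ) : Submodule ℝ (EuclideanSpace ℝ (Fin n)) :=
  Submodule.span ℝ (Set.range fun k : {k : Fin n // k.val < j} =>
    EuclideanSpace.basisFun (Fin n) ℝ k.val)

theorem finrank_coordSubspace {n j : ℕ} (h : j ≤ n) :
    Module.finrank ℝ (coordSubspace n j) = j := by
  have hli : LinearIndependent ℝ (fun k : {k : Fin n // k.val < j} =>
      EuclideanSpace.basisFun (Fin n) ℝ k.val) :=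
    (EuclideanSpace.basisFun (Fin n) ℝ).orthonormal.linearIndependent.comp _
      Subtype.val_injective
  rw [coordSubspace, finrank_span_eq_card hli]
  let e : {k : Fin n // k.val < j} ≃ Fin j :=
    { toFun := fun k => ⟨k.1.1, k.2⟩
      invFun := fun k => ⟨⟨k.1, k.2.trans_le h⟩, k.2⟩
      left_inv := fun _ => rfl
      right_inv := fun _ => rfl }
  rw [Fintype.card_congr e, Fintype.card_fin]

/-- The orthogonal group `O(n)`, as the group of unitary (i.e. orthogonal) operators of `ℝⁿ`, with
the topology and the Borel σ-algebra of the space of operators. -/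
abbrev OrthogonalOperators (n : ℕ) : Type :=
  unitary (EuclideanSpace ℝ (Fin n) →L[ℝ] EuclideanSpace ℝ (Fin n))

instance instContinuousStarOperators (n : ℕ) :
    ContinuousStar (EuclideanSpace ℝ (Fin n) →L[ℝ] EuclideanSpace ℝ (Fin n)) :=
  ⟨(ContinuousLinearMap.adjoint :
    (EuclideanSpace ℝ (Fin n) →L[ℝ] EuclideanSpace ℝ (Fin n)) ≃ₗᵢ⋆[ℝ]
      (EuclideanSpace ℝ (Fin n) →L[ℝ] EuclideanSpace ℝ (Fin n))).continuous⟩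

instance instCompactSpaceOrthogonalOperators (n : ℕ) : CompactSpace (OrthogonalOperators n) := by
  have : ProperSpace (EuclideanSpace ℝ (Fin n) →L[ℝ] EuclideanSpace ℝ (Fin n)) :=
    FiniteDimensional.proper ℝ _
  refine isCompact_iff_compactSpace.mp (Metric.isCompact_of_isClosed_isBounded
    isClosed_unitary ((Metric.isBounded_closedBall (x := 0) (r := 1)).subset ?_))
  intro u hu
  rw [mem_closedBall_zero_iff]
  refine ContinuousLinearMap.opNorm_le_bound _ zero_le_one fun x => ?_
  have h := (Unitary.linearIsometryEquiv (⟨u, hu⟩ : OrthogonalOperators n)).norm_map x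
  rw [one_mul]
  exact h.le

/-- The Haar probability measure of the compact group `O(n)`. -/
noncomputable def orthogonalHaar (n : ℕ) : Measure (OrthogonalOperators n) :=
  Measure.haarMeasure ⊤

/-- The Grassmannian `G_{n,j}` of all `j`-dimensional linear subspaces of `ℝⁿ`. -/
def RealGrassmannian (n j : ℕ) : Type :=
  {E : Submodule ℝ (EuclideanSpace ℝ (Fin n)) // Module.finrank ℝ E = j}

/-- The topology of the Grassmannian: a subspace is identified with the orthogonal projection
onto it. -/
noncomputable instance instTopologicalSpaceRealGrassmannian (n j : ℕ) :
    TopologicalSpace (RealGrassmannian n j) :=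
  TopologicalSpace.induced
    (fun E : RealGrassmannian n j => (E.1.starProjection :
      EuclideanSpace ℝ (Fin n) →L[ℝ] EuclideanSpace ℝ (Fin n))) inferInstance

noncomputable instance instMeasurableSpaceRealGrassmannian (n j : ℕ) :
    MeasurableSpace (RealGrassmannian n j) :=
  borel _

instance instBorelSpaceRealGrassmannian (n j : ℕ) : BorelSpace (RealGrassmannian n j) := ⟨rfl⟩

/-- The action of `O(n)` on `G_{n,j}`: `g` sends a subspace to its image under `g`. -/
noncomputable def RealGrassmannian.rotate {n j : ℕ} (g : OrthogonalOperators n)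
    (E : RealGrassmannian n j) : RealGrassmannian n j :=
  ⟨E.1.map ((Unitary.linearIsometryEquiv g).toLinearEquiv :
      EuclideanSpace ℝ (Fin n) →ₗ[ℝ] EuclideanSpace ℝ (Fin n)),
    (LinearEquiv.finrank_map_eq _ _).trans E.2⟩

/-- The coordinate subspace, as a point of the Grassmannian. -/
noncomputable def RealGrassmannian.base {n j : ℕ} (h : j ≤ n) : RealGrassmannian n j :=
  ⟨coordSubspace n j, finrank_coordSubspace h⟩

/-- The orbit map of a point of the Grassmannian is continuous; in particular it is measurable,
so that the image measure in the next definition is a genuine one. -/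
theorem RealGrassmannian.continuous_rotate {n j : ℕ} (E : RealGrassmannian n j) :
    Continuous fun g : OrthogonalOperators n => E.rotate g := by
  rw [continuous_induced_rng]
  have h : ((fun F : RealGrassmannian n j => (F.1.starProjection :
        EuclideanSpace ℝ (Fin n) →L[ℝ] EuclideanSpace ℝ (Fin n))) ∘
          fun g : OrthogonalOperators n => E.rotate g) =
      fun g : OrthogonalOperators n => (g : EuclideanSpace ℝ (Fin n) →L[ℝ] EuclideanSpace ℝ (Fin n)) *
        E.1.starProjection *
          ((g⁻¹ : OrthogonalOperators n) :
            EuclideanSpace ℝ (Fin n) →L[ℝ] EuclideanSpace ℝ (Fin n)) := by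
    funext g
    ext1 x
    exact Submodule.starProjection_map_apply (Unitary.linearIsometryEquiv g) E.1 x
  rw [h]
  exact (continuous_subtype_val.mul continuous_const).mul
    (continuous_subtype_val.comp continuous_inv)

/-- The Haar probability measure `σ_{n,j}` of the Grassmannian `G_{n,j}`, `j ≤ n`: the image of the
Haar probability measure of `O(n)` under an orbit map (if `j > n`, the Grassmannian is empty). -/
noncomputable def grassmannianHaar (n j : ℕ) : Measure (RealGrassmannian n j) :=
  if h : j ≤ n then
    (orthogonalHaar n).map fun g => (RealGrassmannian.base h).rotate g
  else 0

/-- The orthogonal projection `K|E` of a set `K` onto a subspace `E`, as a subset of `E`. -/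
noncomputable def projOnto {n : ℕ} (K : Set (EuclideanSpace ℝ (Fin n)))
    (E : Submodule ℝ (EuclideanSpace ℝ (Fin n))) : Set E :=
  E.orthogonalProjectionOnto '' K

/-- The volume `κ_m` of the Euclidean unit ball of `ℝᵐ`. -/
noncomputable def unitBallVolume (m : ℕ) : ℝ≥0∞ :=
  volume (Metric.closedBall (0 : EuclideanSpace ℝ (Fin m)) 1)

/-- The `j`-th intrinsic volume of a compact convex set `K` in `ℝⁿ`, by Kubota's formula
`V_j(K) = (n choose j) κ_n / (κ_j κ_{n-j}) ∫_{G_{n,j}} vol_E(K|E) dσ_{n,j}(E)`, where `vol_E` is the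
Lebesgue measure of the Euclidean space `E`. The integrand is nonnegative and bounded, so the
integral is taken in `[0, ∞]`. -/
noncomputable def intrinsicVolume (n j : ℕ) (K : Set (EuclideanSpace ℝ (Fin n))) : ℝ≥0∞ :=
  (n.choose j * unitBallVolume n / (unitBallVolume j * unitBallVolume (n - j))) *
    ∫⁻ E : RealGrassmannian n j, volume (projOnto K E.1) ∂grassmannianHaar n j

/-- The family `𝒦ⁿ` of all compact convex subsets of `ℝⁿ`. -/
def compactConvexSets (n : ℕ) : Set (Set (EuclideanSpace ℝ (Fin n))) :=
  {K | IsCompact K ∧ Convex ℝ K}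

/-- The family `𝒦ⁿ_n` of all convex bodies in `ℝⁿ`: compact convex sets with interior points. -/
def convexBodies (n : ℕ) : Set (Set (EuclideanSpace ℝ (Fin n))) :=
  {K | IsCompact K ∧ Convex ℝ K ∧ (interior K).Nonempty}

/-- `A` is symmetric with respect to the subspace `H`: it is equal to its reflection in `H`. -/
def IsSymmetricAbout {n : ℕ} (H : Submodule ℝ (EuclideanSpace ℝ (Fin n)))
    (A : Set (EuclideanSpace ℝ (Fin n))) : Prop :=
  H.reflection '' A = A

/-- `𝓑_H`: the members of the family `𝓑` that are `H`-symmetric. -/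
def symmetricMembers {n : ℕ} (𝓑 : Set (Set (EuclideanSpace ℝ (Fin n))))
    (H : Submodule ℝ (EuclideanSpace ℝ (Fin n))) : Set (Set (EuclideanSpace ℝ (Fin n))) :=
  {K | K ∈ 𝓑 ∧ IsSymmetricAbout H K}

/-- A symmetrization: any operator `𝓑 → 𝓑_H`. -/
abbrev Symmetrization {n : ℕ} (𝓑 : Set (Set (EuclideanSpace ℝ (Fin n))))
    (H : Submodule ℝ (EuclideanSpace ℝ (Fin n))) : Type :=
  𝓑 → symmetricMembers 𝓑 H

namespace Symmetrization

variable {n : ℕ} {𝓑 : Set (Set (EuclideanSpace ℝ (Fin n)))}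
  {H : Submodule ℝ (EuclideanSpace ℝ (Fin n))}

/-- `K ⊆ L` implies `◇K ⊆ ◇L`. -/
def IsMonotonic (S : Symmetrization 𝓑 H) : Prop :=
  ∀ K L : 𝓑, (K : Set (EuclideanSpace ℝ (Fin n))) ⊆ L →
    (S K : Set (EuclideanSpace ℝ (Fin n))) ⊆ S L

/-- `◇K = K` for all `K` in `𝓑_H`. -/
def IsInvariantOnSymmetric (S : Symmetrization 𝓑 H) : Prop :=
  ∀ K : 𝓑, IsSymmetricAbout H (K : Set (EuclideanSpace ℝ (Fin n))) →
    (S K : Set (EuclideanSpace ℝ (Fin n))) = K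

/-- `F(◇K) = F(K)` for all `K` in `𝓑`. -/
def IsPreserving (F : Set (EuclideanSpace ℝ (Fin n)) → ℝ≥0∞) (S : Symmetrization 𝓑 H) : Prop :=
  ∀ K : 𝓑, F (S K) = F K

end Symmetrization

/-! Choose a `j`-dimensional subspace `E` of `Hᗮ`. The reflection in `H` acts on `E` as `x ↦ -x`,
and on compact subsets of `E` the functional `V_j` is a positive finite multiple of Lebesgue
measure. Approximating bodies of `E` from outside therefore turns the given operator into a
monotone, volume-preserving central symmetrization `S` of the bodies of `E` that fixes the symmetric
ones (`isCentralSymmetrization_restrict`). Since `dim E = j ≥ 2`, `not_isCentralSymmetrization`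
excludes it.

The exclusion starts from a width bound. If `Q` is a bipyramid with apexes `a • u`, `-b • u`, then
`S Q` contains the equator of `Q`, and with any point `y` also `-y`, hence the two pyramids from the
equator to `±y`. Comparing volumes gives `ℓ y ≤ (a + b) / 2`. Enclosing an arbitrary body in flat
bipyramids bounds the support function of `S K` by half the width of `K` (`apply_le`). So for `D`
symmetric and `z ∈ D`, `S (z + D) ⊆ D`, and equality of volumes gives `interior D ⊆ S (z + D)`. By
monotonicity, a body `K` with `0, 2z ∈ K` and `z ± x ∈ interior K` has `x ∈ S K`
(`mem_of_add_sub_mem_interior`).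

For `Q` with apexes `3u`, `-u`, this criterion fills the whole bipyramid `X` with apexes `±2u`,
which has at least the volume of `Q`, and also yields a point outside `X`. Then `S Q` has too much
volume. -/

/-! ### Bipyramids: convexity, compactness and volume comparison -/

section Bipyramids

open Set Metric Module

variable {E : Type*} [NormedAddCommGroup E] [NormedSpace ℝ E]

/-- The projection along `u` onto the kernel of `ℓ` (when `ℓ u = 1`). -/
def alongProj (ℓ : E →L[ℝ] ℝ) (u x : E) : E := x - ℓ x • u

/-- The gauge of the bipyramid with equator `{ℓ = 0, r * ‖x‖ ≤ 1}` and apexes `a • u`, `-b • u`. -/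
noncomputable def bipyramidGauge (ℓ : E →L[ℝ] ℝ) (u : E) (r a b : ℝ) (x : E) : ℝ :=
  r * ‖alongProj ℓ u x‖ + max (ℓ x / a) (-ℓ x / b)

/-- The bipyramid with equator `{ℓ = 0, r * ‖x‖ ≤ 1}` and apexes `a • u`, `-b • u`. -/
def bipyramid (ℓ : E →L[ℝ] ℝ) (u : E) (r a b : ℝ) : Set E :=
  {x | bipyramidGauge ℓ u r a b x ≤ 1}

/-- The pyramid with base `{ℓ = 0, r * ‖x‖ ≤ 1}` and apex `u`. -/
def halfPyramid (ℓ : E →L[ℝ] ℝ) (u : E) (r : ℝ) : Set E :=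
  {x | 0 ≤ ℓ x ∧ r * ‖alongProj ℓ u x‖ + ℓ x ≤ 1}

variable {ℓ : E →L[ℝ] ℝ} {u : E} {r a b : ℝ}

theorem alongProj_add (x y : E) :
    alongProj ℓ u (x + y) = alongProj ℓ u x + alongProj ℓ u y := by
  simp only [alongProj, map_add]; module

theorem alongProj_smul (c : ℝ) (x : E) : alongProj ℓ u (c • x) = c • alongProj ℓ u x := by
  simp only [alongProj, map_smul, smul_eq_mul]; module

theorem alongProj_neg (x : E) : alongProj ℓ u (-x) = -alongProj ℓ u x := by
  simp only [alongProj, map_neg]; module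

theorem continuous_alongProj : Continuous (alongProj ℓ u) := by
  unfold alongProj; fun_prop

theorem continuous_bipyramidGauge : Continuous (bipyramidGauge ℓ u r a b) := by
  have := continuous_alongProj (ℓ := ℓ) (u := u)
  unfold bipyramidGauge; fun_prop

theorem max_div_nonneg (ha : 0 < a) (hb : 0 < b) (t : ℝ) : 0 ≤ max (t / a) (-t / b) := by
  rcases le_total 0 t with h | h
  · exact le_max_of_le_left (by positivity)
  · exact le_max_of_le_right (div_nonneg (by linarith) hb.le)

theorem bipyramidGauge_smul {c : ℝ} (hc : 0 ≤ c) (x : E) :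
    bipyramidGauge ℓ u r a b (c • x) = c * bipyramidGauge ℓ u r a b x := by
  simp only [bipyramidGauge, alongProj_smul, norm_smul, Real.norm_of_nonneg hc, map_smul,
    smul_eq_mul, mul_add, mul_max_of_nonneg _ _ hc]
  congr 1
  · ring
  · congr 1 <;> ring

theorem bipyramidGauge_add_le (hr : 0 ≤ r) (x y : E) :
    bipyramidGauge ℓ u r a b (x + y) ≤
      bipyramidGauge ℓ u r a b x + bipyramidGauge ℓ u r a b y := by
  have h1 := mul_le_mul_of_nonneg_left (norm_add_le (alongProj ℓ u x) (alongProj ℓ u y)) hr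
  have h2 : max (ℓ (x + y) / a) (-ℓ (x + y) / b) ≤
      max (ℓ x / a) (-ℓ x / b) + max (ℓ y / a) (-ℓ y / b) := by
    rw [map_add]
    refine max_le ?_ ?_
    · rw [add_div]; exact add_le_add (le_max_left _ _) (le_max_left _ _)
    · rw [neg_add, add_div]; exact add_le_add (le_max_right _ _) (le_max_right _ _)
  simp only [bipyramidGauge, alongProj_add] at *
  linarith

theorem convex_bipyramid (hr : 0 ≤ r) :
    Convex ℝ (bipyramid ℓ u r a b) := by
  intro x hx y hy s t hs ht hst
  simp only [bipyramid, mem_ofPred_eq] at *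
  calc _ ≤ _ := bipyramidGauge_add_le hr _ _
    _ = s * bipyramidGauge ℓ u r a b x + t * bipyramidGauge ℓ u r a b y := by
      rw [bipyramidGauge_smul hs, bipyramidGauge_smul ht]
    _ ≤ s * 1 + t * 1 := by gcongr
    _ = 1 := by linarith

theorem isCompact_bipyramid [ProperSpace E] (hr : 0 < r) (ha : 0 < a) (hb : 0 < b) :
    IsCompact (bipyramid ℓ u r a b) := by
  refine Metric.isCompact_of_isClosed_isBounded
    (isClosed_le continuous_bipyramidGauge continuous_const) ?_
  refine (isBounded_closedBall (x := (0 : E)) (r := 1 / r + (a + b) * ‖u‖)).subset fun x hx => ?_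
  have hx : r * ‖alongProj ℓ u x‖ + max (ℓ x / a) (-ℓ x / b) ≤ 1 := hx
  have hm := max_div_nonneg ha hb (ℓ x)
  have hp : 0 ≤ r * ‖alongProj ℓ u x‖ := by positivity
  have h1 : ‖alongProj ℓ u x‖ ≤ 1 / r := by
    rw [le_div_iff₀ hr]; linarith
  have h2 : ℓ x ≤ a := by
    have := (le_max_left (ℓ x / a) (-ℓ x / b)).trans (by linarith : _ ≤ (1 : ℝ))
    rwa [div_le_one ha] at this
  have h3 : -ℓ x ≤ b := by
    have := (le_max_right (ℓ x / a) (-ℓ x / b)).trans (by linarith : _ ≤ (1 : ℝ))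
    rwa [div_le_one hb] at this
  rw [mem_closedBall_zero_iff]
  calc ‖x‖ = ‖alongProj ℓ u x + ℓ x • u‖ := by simp [alongProj]
    _ ≤ ‖alongProj ℓ u x‖ + |ℓ x| * ‖u‖ := by
      rw [← Real.norm_eq_abs, ← norm_smul]; exact norm_add_le _ _
    _ ≤ _ := by
      gcongr
      exact abs_le.mpr ⟨by linarith, by linarith⟩

theorem bipyramidGauge_lt_one_subset_interior :
    {x | bipyramidGauge ℓ u r a b x < 1} ⊆ interior (bipyramid ℓ u r a b) :=
  interior_maximal (fun _ hx => le_of_lt (show bipyramidGauge ℓ u r a b _ < 1 from hx))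
    (isOpen_lt continuous_bipyramidGauge continuous_const)

theorem bipyramidGauge_zero : bipyramidGauge ℓ u r a b 0 = 0 := by
  simp [bipyramidGauge, alongProj]

theorem nonempty_interior_bipyramid : (interior (bipyramid ℓ u r a b)).Nonempty :=
  ⟨0, bipyramidGauge_lt_one_subset_interior (by simp [bipyramidGauge_zero])⟩

theorem neg_mem_bipyramid {x : E} (hx : x ∈ bipyramid ℓ u r a a) :
    -x ∈ bipyramid ℓ u r a a := by
  simpa [bipyramid, bipyramidGauge, alongProj_neg, max_comm] using hx

theorem bipyramid_mono {a' b' : ℝ} (ha : 0 < a) (hb : 0 < b) (haa : a ≤ a') (hbb : b ≤ b') :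
    bipyramid ℓ u r a b ⊆ bipyramid ℓ u r a' b' := by
  intro x hx
  simp only [bipyramid, bipyramidGauge, mem_ofPred_eq] at *
  refine le_trans ?_ hx
  have ha' := ha.trans_le haa
  have hb' := hb.trans_le hbb
  refine add_le_add le_rfl ?_
  rcases le_total 0 (ℓ x) with h | h
  · rw [max_eq_left (a := ℓ x / a')]
    · exact le_max_of_le_left (by gcongr)
    · exact (div_nonpos_of_nonpos_of_nonneg (by linarith) hb'.le).trans (by positivity)
  · have h' : 0 ≤ -ℓ x := by linarith
    rw [max_eq_right (a := ℓ x / a')]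
    · exact le_max_of_le_right (by gcongr)
    · exact (div_nonpos_of_nonpos_of_nonneg h ha'.le).trans (by positivity)

theorem equator_subset_bipyramid {x : E} (hℓ : ℓ x = 0) (hx : r * ‖x‖ ≤ 1) :
    x ∈ bipyramid ℓ u r a b := by
  simpa [bipyramid, bipyramidGauge, alongProj, hℓ] using hx

/-- The transvection fixes `ker ℓ` and sends `u` to `y`, so a convex combination of an equator point
and `u` becomes the same combination of that equator point and `y`. -/
theorem transvection_image_halfPyramid_subset {C : Set E} (hu : ℓ u = 1) (hr : 0 < r)
    (hC : Convex ℝ C) (hM : ∀ x, ℓ x = 0 → r * ‖x‖ ≤ 1 → x ∈ C) {y : E} (hy : y ∈ C) :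
    LinearMap.transvection (ℓ : E →ₗ[ℝ] ℝ) (y - u) '' halfPyramid ℓ u r ⊆ C := by
  rintro _ ⟨x, ⟨h0, h1⟩, rfl⟩
  have hp : 0 ≤ r * ‖alongProj ℓ u x‖ := by positivity
  have hT : LinearMap.transvection (ℓ : E →ₗ[ℝ] ℝ) (y - u) x = alongProj ℓ u x + ℓ x • y := by
    simp only [LinearMap.transvection.apply, alongProj, ContinuousLinearMap.coe_coe]; module
  rw [hT]
  have hker : ℓ (alongProj ℓ u x) = 0 := by simp [alongProj, hu]
  rcases eq_or_lt_of_le (show ℓ x ≤ 1 by linarith) with h | h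
  · have : alongProj ℓ u x = 0 := by
      rw [← norm_le_zero_iff]
      have : r * ‖alongProj ℓ u x‖ ≤ 0 := by linarith
      exact nonpos_of_mul_nonpos_right this hr
    simpa [this, h] using hy
  · have hpos : 0 < 1 - ℓ x := by linarith
    have := hC (hM ((1 - ℓ x)⁻¹ • alongProj ℓ u x) (by simp [hker]) (by
      rw [norm_smul, norm_inv, Real.norm_of_nonneg hpos.le, mul_left_comm, inv_mul_le_one₀ hpos]
      linarith)) hy hpos.le h0 (by ring)
    rwa [smul_smul, mul_inv_cancel₀ hpos.ne', one_smul] at this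

theorem isCompact_halfPyramid [ProperSpace E] (hr : 0 < r) : IsCompact (halfPyramid ℓ u r) := by
  refine (isCompact_bipyramid (ℓ := ℓ) (u := u) hr one_pos one_pos).of_isClosed_subset ?_ ?_
  · have := continuous_alongProj (ℓ := ℓ) (u := u)
    have hf : Continuous fun x => r * ‖alongProj ℓ u x‖ + ℓ x := by fun_prop
    exact (isClosed_le continuous_const ℓ.continuous).inter (isClosed_le hf continuous_const)
  · rintro x ⟨h0, h1⟩
    have : max (ℓ x / 1) (-ℓ x / 1) = ℓ x := by
      rw [div_one, div_one]; exact max_eq_left (by linarith)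
    rwa [bipyramid, mem_ofPred_eq, bipyramidGauge, this]

theorem nonempty_interior_halfPyramid (hu : ℓ u = 1) :
    (interior (halfPyramid ℓ u r)).Nonempty := by
  have hc := continuous_alongProj (ℓ := ℓ) (u := u)
  have hf : Continuous fun x => r * ‖alongProj ℓ u x‖ + ℓ x := by fun_prop
  have ho : IsOpen {x | 0 < ℓ x ∧ r * ‖alongProj ℓ u x‖ + ℓ x < 1} :=
    (isOpen_lt continuous_const ℓ.continuous).inter (isOpen_lt hf continuous_const)
  refine ⟨(1 / 2 : ℝ) • u, interior_maximal (fun x hx => And.intro (le_of_lt hx.1) (le_of_lt hx.2)) ho ?_⟩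
  constructor <;> norm_num [alongProj, hu]

variable [FiniteDimensional ℝ E] [MeasurableSpace E] [BorelSpace E]
  (μ : Measure E) [μ.IsAddHaarMeasure]

/-- The determinant of the transvection is `1 + ℓ (y - u) = ℓ y`. -/
theorem measure_transvection_image (hu : ℓ u = 1) (y : E) (s : Set E) :
    μ (LinearMap.transvection (ℓ : E →ₗ[ℝ] ℝ) (y - u) '' s) = ENNReal.ofReal |ℓ y| * μ s := by
  rw [Measure.addHaar_image_linearMap, LinearMap.transvection.det]
  simp [hu]

theorem measure_bipyramid_le (hu : ℓ u = 1) (ha : 0 < a) (hb : 0 < b) :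
    μ (bipyramid ℓ u r a b) ≤ ENNReal.ofReal (a + b) * μ (halfPyramid ℓ u r) := by
  -- Used with `c = a` for the upper half and `c = -b` for the lower half; the preimage keeps the
  -- component along `ker ℓ` and rescales the height to `ℓ x / c`.
  have key : ∀ (c : ℝ), c ≠ 0 → ∀ x, 0 ≤ ℓ x / c → r * ‖alongProj ℓ u x‖ + ℓ x / c ≤ 1 →
      x ∈ LinearMap.transvection (ℓ : E →ₗ[ℝ] ℝ) (c • u - u) '' halfPyramid ℓ u r := by
    intro c hc x h0 h1
    have hℓ : ℓ (alongProj ℓ u x + (ℓ x / c) • u) = ℓ x / c := by simp [alongProj, hu]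
    have hp : alongProj ℓ u (alongProj ℓ u x + (ℓ x / c) • u) = alongProj ℓ u x := by
      rw [alongProj, hℓ]; module
    refine ⟨alongProj ℓ u x + (ℓ x / c) • u, ⟨by rwa [hℓ], by rwa [hℓ, hp]⟩, ?_⟩
    rw [LinearMap.transvection.apply, ContinuousLinearMap.coe_coe, hℓ, smul_sub, smul_smul,
      div_mul_cancel₀ _ hc, alongProj]
    module
  have hsub : bipyramid ℓ u r a b ⊆
      LinearMap.transvection (ℓ : E →ₗ[ℝ] ℝ) (a • u - u) '' halfPyramid ℓ u r ∪
      LinearMap.transvection (ℓ : E →ₗ[ℝ] ℝ) ((-b) • u - u) '' halfPyramid ℓ u r := by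
    intro x hx
    have hx : r * ‖alongProj ℓ u x‖ + max (ℓ x / a) (-ℓ x / b) ≤ 1 := hx
    rcases le_total 0 (ℓ x) with h | h
    · refine Or.inl (key a ha.ne' x (by positivity) (le_trans ?_ hx))
      exact add_le_add le_rfl (le_max_left _ _)
    · have h' : -ℓ x / b = ℓ x / -b := by rw [div_neg, neg_div]
      refine Or.inr (key (-b) (by linarith) x ?_ (le_trans ?_ hx))
      · rw [← h']; exact div_nonneg (by linarith) hb.le
      · rw [← h']; exact add_le_add le_rfl (le_max_right _ _)
  refine (measure_mono hsub).trans ((measure_union_le _ _).trans ?_)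
  rw [measure_transvection_image μ hu, measure_transvection_image μ hu, ← add_mul,
    ← ENNReal.ofReal_add (abs_nonneg _) (abs_nonneg _)]
  simp [hu, abs_of_pos ha, abs_of_pos hb]

theorem le_measure_of_equator_subset {C : Set E} (hu : ℓ u = 1) (hr : 0 < r)
    (hC : Convex ℝ C) (hM : ∀ x, ℓ x = 0 → r * ‖x‖ ≤ 1 → x ∈ C) {y : E} (hy : y ∈ C)
    (hy' : -y ∈ C) (hℓ : 0 ≤ ℓ y) :
    ENNReal.ofReal (2 * ℓ y) * μ (halfPyramid ℓ u r) ≤ μ C := by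
  set A := LinearMap.transvection (ℓ : E →ₗ[ℝ] ℝ) (y - u) '' halfPyramid ℓ u r with hA
  set B := LinearMap.transvection (ℓ : E →ₗ[ℝ] ℝ) (-y - u) '' halfPyramid ℓ u r with hB
  have hAC : A ⊆ C := transvection_image_halfPyramid_subset hu hr hC hM hy
  have hBC : B ⊆ C := transvection_image_halfPyramid_subset hu hr hC hM hy'
  have hℓT : ∀ z x, ℓ (LinearMap.transvection (ℓ : E →ₗ[ℝ] ℝ) (z - u) x) = ℓ x * ℓ z := by
    intro z x
    simp only [LinearMap.transvection.apply, ContinuousLinearMap.coe_coe, map_add, map_smul,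
      map_sub, hu, smul_eq_mul]
    ring
  have hmeas : MeasurableSet B :=
    ((isCompact_halfPyramid hr).image (LinearMap.continuous_of_finiteDimensional _)).measurableSet
  -- `ℓ ≥ 0` on `A` and `ℓ ≤ 0` on `B`, so they meet only in the null set `ker ℓ`.
  have hdisj : AEDisjoint μ A B := by
    refine measure_mono_null (t := (ℓ.ker : Set E)) ?_ ?_
    · rintro x ⟨⟨p, hp, rfl⟩, ⟨q, hq, hqp⟩⟩
      have h1 := hℓT y p
      have h2 := hℓT (-y) q
      rw [hqp, map_neg] at h2
      have h3 : 0 ≤ ℓ p * ℓ y := mul_nonneg hp.1 hℓ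
      have h4 : 0 ≤ ℓ q * ℓ y := mul_nonneg hq.1 hℓ
      show ℓ _ = 0
      linarith
    · refine Measure.addHaar_submodule μ _ fun h => ?_
      have : u ∈ ℓ.ker := h ▸ Submodule.mem_top
      have : ℓ u = 0 := this
      linarith
  calc _ = μ A + μ B := by
        rw [hA, hB, measure_transvection_image μ hu, measure_transvection_image μ hu, ← add_mul,
          ← ENNReal.ofReal_add (abs_nonneg _) (abs_nonneg _), map_neg, abs_neg, abs_of_nonneg hℓ,
          two_mul]
    _ = μ (A ∪ B) := (measure_union₀ hmeas.nullMeasurableSet hdisj).symm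
    _ ≤ μ C := measure_mono (union_subset hAC hBC)

end Bipyramids

/-! ### Volume-preserving central symmetrizations do not exist in dimension at least two -/

section CentralSymmetrization

open Set Metric Module

variable {E : Type*} [NormedAddCommGroup E] [NormedSpace ℝ E]

/-- Compact convex sets with interior points. -/
structure IsBody (K : Set E) : Prop where
  isCompact : IsCompact K
  convex : Convex ℝ K
  nonempty_interior : (interior K).Nonempty

theorem isBody_bipyramid [ProperSpace E] {ℓ : E →L[ℝ] ℝ} {u : E} {r a b : ℝ}
    (hr : 0 < r) (ha : 0 < a) (hb : 0 < b) : IsBody (bipyramid ℓ u r a b) :=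
  ⟨isCompact_bipyramid hr ha hb, convex_bipyramid hr.le, nonempty_interior_bipyramid⟩

/-- Monotone operators on bodies whose values are compact, convex and centrally symmetric, which
fix the centrally symmetric bodies and preserve the measure `μ`. -/
structure IsCentralSymmetrization [MeasurableSpace E] (μ : Measure E) (S : Set E → Set E) :
    Prop where
  isCompact : ∀ K, IsBody K → IsCompact (S K)
  convex : ∀ K, IsBody K → Convex ℝ (S K)
  neg_mem : ∀ K, IsBody K → ∀ x ∈ S K, -x ∈ S K
  mono : ∀ K L, IsBody K → IsBody L → K ⊆ L → S K ⊆ S L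
  eq_self : ∀ K, IsBody K → (∀ x ∈ K, -x ∈ K) → S K = K
  measure_eq : ∀ K, IsBody K → μ (S K) = μ K

namespace IsCentralSymmetrization

variable [FiniteDimensional ℝ E] [MeasurableSpace E] {μ : Measure E} {S : Set E → Set E}

/-- The bipyramid with both apex heights `min a b` is symmetric, hence fixed, and has the same
equator. -/
theorem equator_subset (hS : IsCentralSymmetrization μ S) {ℓ : E →L[ℝ] ℝ} {u : E} {r a b : ℝ}
    (hr : 0 < r) (ha : 0 < a) (hb : 0 < b) {x : E} (hℓ : ℓ x = 0) (hx : r * ‖x‖ ≤ 1) :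
    x ∈ S (bipyramid ℓ u r a b) := by
  have : ProperSpace E := FiniteDimensional.proper ℝ E
  have hc : 0 < min a b := lt_min ha hb
  refine hS.mono _ _ (isBody_bipyramid hr hc hc) (isBody_bipyramid hr ha hb)
    (bipyramid_mono hc hc (min_le_left _ _) (min_le_right _ _)) ?_
  rw [hS.eq_self _ (isBody_bipyramid hr hc hc) fun _ => neg_mem_bipyramid]
  exact equator_subset_bipyramid hℓ hx

variable [BorelSpace E] [μ.IsAddHaarMeasure]

/-- The values of functionals on the symmetrization of a bipyramid are at most half of the width. -/
theorem apply_le_of_mem_bipyramid (hS : IsCentralSymmetrization μ S) {ℓ : E →L[ℝ] ℝ} {u : E}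
    {r a b : ℝ} (hu : ℓ u = 1) (hr : 0 < r) (ha : 0 < a) (hb : 0 < b) {y : E}
    (hy : y ∈ S (bipyramid ℓ u r a b)) : ℓ y ≤ (a + b) / 2 := by
  have : ProperSpace E := FiniteDimensional.proper ℝ E
  have hQ : IsBody (bipyramid ℓ u r a b) := isBody_bipyramid hr ha hb
  rcases le_total (ℓ y) 0 with h | h
  · linarith
  have h1 := le_measure_of_equator_subset μ hu hr (hS.convex _ hQ)
    (fun x hx hx' => hS.equator_subset hr ha hb hx hx') hy (hS.neg_mem _ hQ y hy) h
  rw [hS.measure_eq _ hQ] at h1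
  have h2 := h1.trans (measure_bipyramid_le μ hu ha hb)
  rw [ENNReal.mul_le_mul_iff_left
    (Measure.measure_pos_of_nonempty_interior μ (nonempty_interior_halfPyramid hu)).ne'
    (isCompact_halfPyramid hr).measure_ne_top, ENNReal.ofReal_le_ofReal_iff (by linarith)] at h2
  linarith

/-- The slack `c` leaves room to enclose `K` in a bipyramid with apex heights `a`, `b` and a very
wide equator, that is, a small `r`. -/
theorem apply_le (hS : IsCentralSymmetrization μ S) {ℓ : E →L[ℝ] ℝ} {K : Set E} (hK : IsBody K)
    {a b c : ℝ} (hca : c < a) (hcb : c < b) (ha : 0 < a) (hb : 0 < b)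
    (hKa : ∀ x ∈ K, ℓ x ≤ a - c) (hKb : ∀ x ∈ K, -ℓ x ≤ b - c) (hc : 0 < c)
    {y : E} (hy : y ∈ S K) : ℓ y ≤ (a + b) / 2 := by
  have : ProperSpace E := FiniteDimensional.proper ℝ E
  rcases le_or_gt (ℓ y) 0 with h | h
  · linarith
  set u := (ℓ y)⁻¹ • y with hu'
  have hu : ℓ u = 1 := by simp [hu', h.ne']
  obtain ⟨D, hD⟩ := (hK.isCompact.image
    (continuous_alongProj (ℓ := ℓ) (u := u))).isBounded.exists_norm_le
  have hD0 : ∀ x ∈ K, ‖alongProj ℓ u x‖ ≤ max D 1 := fun x hx =>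
    (hD _ (mem_image_of_mem _ hx)).trans (le_max_left _ _)
  have hDpos : 0 < max D 1 := lt_max_of_lt_right one_pos
  set m := max a b with hm
  have hm0 : 0 < m := lt_max_of_lt_left ha
  -- With this `r` the equatorial term of the gauge is at most `c / m` on `K`, while the height term
  -- is at most `1 - c / m`.
  set r := c / m / max D 1 with hr'
  have hr : 0 < r := by positivity
  refine hS.apply_le_of_mem_bipyramid hu hr ha hb (hS.mono _ _ hK (isBody_bipyramid hr ha hb) ?_ hy)
  intro x hx
  have h1 : r * ‖alongProj ℓ u x‖ ≤ c / m := by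
    calc _ ≤ r * max D 1 := by gcongr; exact hD0 x hx
      _ = c / m := by rw [hr']; field_simp
  have h2 : ℓ x / a ≤ 1 - c / m := by
    calc ℓ x / a ≤ (a - c) / a := by gcongr; exact hKa x hx
      _ = 1 - c / a := by field_simp
      _ ≤ _ := by gcongr; exact le_max_left _ _
  have h3 : -ℓ x / b ≤ 1 - c / m := by
    calc -ℓ x / b ≤ (b - c) / b := by gcongr; exact hKb x hx
      _ = 1 - c / b := by field_simp
      _ ≤ _ := by gcongr; exact le_max_right _ _
  show _ + _ ≤ (1 : ℝ)
  linarith [max_le h2 h3]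

theorem translate_subset (hS : IsCentralSymmetrization μ S) {D : Set E} (hD : IsBody D)
    (hsymm : ∀ x ∈ D, -x ∈ D) {z : E} (hz : z ∈ D) (hzD : IsBody ((z + ·) '' D)) :
    S ((z + ·) '' D) ⊆ D := by
  intro y hy
  by_contra hyD
  obtain ⟨ℓ, s, t, hs, hst, ht⟩ := geometric_hahn_banach_compact_closed hD.convex hD.isCompact
    (convex_singleton y) isClosed_singleton (disjoint_singleton_right.mpr hyD)
  have ht := ht y rfl
  have hz1 := hs z hz
  have hz2 := hs _ (hsymm z hz)
  rw [map_neg] at hz2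
  -- On `z + D`, `ℓ` lies between `ℓ z - s` and `ℓ z + s`. Replacing `s` by `t` gives the slack `t -
  -- s`, and `(a + b) / 2 = t < ℓ y` is the contradiction. As `±z ∈ D`, `|ℓ z| < s < t`, so `a` and
  -- `b` are positive; the inner minimum keeps `c` below both.
  have h := hS.apply_le (ℓ := ℓ) hzD (a := ℓ z + t) (b := t - ℓ z) (c := min (t - s)
    (min ((ℓ z + t) / 2) ((t - ℓ z) / 2)))
    ((min_le_right _ _).trans_lt ((min_le_left _ _).trans_lt (by linarith)))
    ((min_le_right _ _).trans_lt ((min_le_right _ _).trans_lt (by linarith)))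
    (by linarith) (by linarith) ?_ ?_ ?_ hy
  · linarith
  · rintro _ ⟨d, hd, rfl⟩
    have := hs d hd
    have := min_le_left (t - s) (min ((ℓ z + t) / 2) ((t - ℓ z) / 2))
    simp only [map_add]
    linarith
  · rintro _ ⟨d, hd, rfl⟩
    have := hs _ (hsymm d hd)
    have := min_le_left (t - s) (min ((ℓ z + t) / 2) ((t - ℓ z) / 2))
    simp only [map_add, map_neg] at *
    linarith
  · exact lt_min (by linarith) (lt_min (by linarith) (by linarith))

theorem interior_subset_translate (hS : IsCentralSymmetrization μ S) {D : Set E} (hD : IsBody D)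
    (hsymm : ∀ x ∈ D, -x ∈ D) {z : E} (hz : z ∈ D) (hzD : IsBody ((z + ·) '' D)) :
    interior D ⊆ S ((z + ·) '' D) := by
  intro x hx
  by_contra hxS
  have hsub := hS.translate_subset hD hsymm hz hzD
  have hcl := (hS.isCompact _ hzD).isClosed
  have hopen : IsOpen (interior D \ S ((z + ·) '' D)) := isOpen_interior.sdiff hcl
  have hpos := hopen.measure_pos μ ⟨x, hx, hxS⟩
  have hdisj : Disjoint (interior D \ S ((z + ·) '' D)) (S ((z + ·) '' D)) := disjoint_sdiff_left
  have h1 : μ (interior D \ S ((z + ·) '' D)) + μ (S ((z + ·) '' D)) ≤ μ D := by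
    rw [← measure_union hdisj hcl.measurableSet]
    exact measure_mono (union_subset (sdiff_subset.trans interior_subset) hsub)
  rw [hS.measure_eq _ hzD] at h1
  have h2 : μ ((z + ·) '' D) = μ D := by simp
  rw [h2] at h1
  have hfin : μ D ≠ ∞ := hD.isCompact.measure_ne_top
  exact hpos.ne' (by simpa using ENNReal.le_sub_of_add_le_right hfin h1)

/-- Take `D = (K - z) ∩ (z - K)`: it is symmetric, `z + D ⊆ K`, and `0, 2z ∈ K` says exactly that `z
∈ D`. -/
theorem mem_of_add_sub_mem_interior (hS : IsCentralSymmetrization μ S) {K : Set E} (hK : IsBody K)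
    {x z : E} (h0 : (0 : E) ∈ K) (hz : z + z ∈ K) (h1 : z + x ∈ interior K)
    (h2 : z - x ∈ interior K) : x ∈ S K := by
  set D := {d | z + d ∈ K} ∩ {d | z - d ∈ K} with hD'
  have hadd : Continuous fun d => z + d := by fun_prop
  have hsub : Continuous fun d => z - d := by fun_prop
  have hint : x ∈ interior D :=
    interior_maximal (fun d (hd : z + d ∈ interior K ∧ z - d ∈ interior K) =>
      And.intro (interior_subset hd.1) (interior_subset hd.2))
      ((isOpen_interior.preimage hadd).inter (isOpen_interior.preimage hsub)) ⟨h1, h2⟩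
  have hconv : Convex ℝ D := by
    intro p hp q hq s t hs ht hst
    constructor
    · have := hK.convex hp.1 hq.1 hs ht hst
      show z + _ ∈ K
      convert! this using 1
      obtain rfl : t = 1 - s := by linarith
      module
    · have := hK.convex hp.2 hq.2 hs ht hst
      show z - _ ∈ K
      convert! this using 1
      obtain rfl : t = 1 - s := by linarith
      module
  have hcomp : IsCompact D :=
    ((Homeomorph.addLeft z).isClosedEmbedding.isCompact_preimage hK.isCompact).inter_right
      (hK.isCompact.isClosed.preimage hsub)
  have hD : IsBody D := ⟨hcomp, hconv, ⟨x, hint⟩⟩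
  have hzD : IsBody ((z + ·) '' D) := by
    refine ⟨hcomp.image hadd, hconv.translate z, ?_⟩
    have := (Homeomorph.addLeft z).image_interior D
    simp only [Homeomorph.coe_addLeft] at this
    rw [← this]
    exact ⟨_, mem_image_of_mem _ hint⟩
  refine hS.mono _ _ hzD hK ?_ (hS.interior_subset_translate hD ?_ ?_ hzD hint)
  · rintro _ ⟨d, hd, rfl⟩; exact hd.1
  · rintro d ⟨hd1, hd2⟩
    exact ⟨by simpa [sub_eq_add_neg] using hd2, by simpa using hd1⟩
  · exact ⟨hz, by simpa using h0⟩

end IsCentralSymmetrization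

/-- In dimension at least two there is no such operator. -/
theorem not_isCentralSymmetrization {E : Type*} [NormedAddCommGroup E] [InnerProductSpace ℝ E]
    [FiniteDimensional ℝ E] [MeasurableSpace E] [BorelSpace E] (μ : Measure E)
    [μ.IsAddHaarMeasure] (hE : 2 ≤ finrank ℝ E) (S : Set E → Set E) :
    ¬ IsCentralSymmetrization μ S := by
  intro hS
  have : ProperSpace E := FiniteDimensional.proper ℝ E
  set e := stdOrthonormalBasis ℝ E
  set u := e ⟨0, by omega⟩ with hu'
  set m := e ⟨1, by omega⟩ with hm'
  set ℓ : E →L[ℝ] ℝ := innerSL ℝ u with hℓ'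
  have hu : ℓ u = 1 := by simp [hℓ', hu']
  have hm : ℓ m = 0 := by
    simp [hℓ', hu', hm']
  have hmn : ‖m‖ = 1 := e.orthonormal.1 _
  have hQ : IsBody (bipyramid ℓ u 1 3 1) := isBody_bipyramid one_pos (by norm_num) one_pos
  have h0 : (0 : E) ∈ bipyramid ℓ u 1 3 1 := by simp [bipyramid, bipyramidGauge_zero]
  have hint : ∀ {x}, bipyramidGauge ℓ u 1 3 1 x < 1 → x ∈ interior (bipyramid ℓ u 1 3 1) :=
    fun hx => bipyramidGauge_lt_one_subset_interior hx
  have hopen : ∀ x, bipyramidGauge ℓ u 1 2 2 x < 1 → x ∈ S (bipyramid ℓ u 1 3 1) := by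
    intro x hx
    have hx : 1 * ‖alongProj ℓ u x‖ + max (ℓ x / 2) (-ℓ x / 2) < 1 := hx
    have hp := norm_nonneg (alongProj ℓ u x)
    have hl1 := le_max_left (ℓ x / 2) (-ℓ x / 2)
    have hl2 := le_max_right (ℓ x / 2) (-ℓ x / 2)
    have habs1 := le_abs_self (ℓ x)
    have habs2 := neg_abs_le (ℓ x)
    have habs3 : |ℓ x| ≤ 2 * max (ℓ x / 2) (-ℓ x / 2) := abs_le.mpr ⟨by linarith, by linarith⟩
    have habs4 := abs_nonneg (ℓ x)
    have hproj : ∀ c : ℝ, alongProj ℓ u (c • u + x) = alongProj ℓ u x := by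
      intro c; simp only [alongProj, map_add, map_smul, hu, smul_eq_mul]; module
    have hproj' : ∀ c : ℝ, alongProj ℓ u (c • u - x) = -alongProj ℓ u x := by
      intro c; simp only [alongProj, map_sub, map_smul, hu, smul_eq_mul]; module
    -- The shift moves the heights `±|ℓ x|` of `±x` to `3|ℓ x|/2` and `-|ℓ x|/2`, matching the apex
    -- ratio `3 : 1`.
    refine hS.mem_of_add_sub_mem_interior hQ (z := (|ℓ x| / 2) • u) h0 ?_ (hint ?_) (hint ?_)
    · have : alongProj ℓ u ((|ℓ x| / 2) • u + (|ℓ x| / 2) • u) = 0 := by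
        simp only [alongProj, map_add, map_smul, hu, smul_eq_mul]; module
      simp only [bipyramid, mem_ofPred_eq, bipyramidGauge, this, norm_zero, map_add, map_smul, hu,
        smul_eq_mul]
      rw [mul_zero, zero_add, max_le_iff]
      constructor <;> linarith
    · simp only [bipyramidGauge, hproj, map_add, map_smul, hu, smul_eq_mul]
      rw [← lt_sub_iff_add_lt', max_lt_iff]
      constructor <;> linarith
    · simp only [bipyramidGauge, hproj', norm_neg, map_sub, map_smul, hu, smul_eq_mul]
      rw [← lt_sub_iff_add_lt', max_lt_iff]
      constructor <;> linarith
  have hXS : bipyramid ℓ u 1 2 2 ⊆ S (bipyramid ℓ u 1 3 1) := by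
    intro x hx
    have hlim : Filter.Tendsto (fun t : ℝ => t • x) (nhdsWithin 1 (Ico 0 1)) (nhds x) := by
      have : Continuous fun t : ℝ => t • x := by fun_prop
      simpa using (this.tendsto 1).mono_left nhdsWithin_le_nhds
    have : (nhdsWithin (1 : ℝ) (Ico 0 1)).NeBot := by
      rw [← mem_closure_iff_nhdsWithin_neBot, closure_Ico (by norm_num)]
      exact ⟨by norm_num, le_rfl⟩
    refine (hS.isCompact _ hQ).isClosed.mem_of_tendsto hlim
      (eventually_nhdsWithin_of_forall fun t ht => hopen _ ?_)
    rw [bipyramidGauge_smul ht.1]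
    have hx : bipyramidGauge ℓ u 1 2 2 x ≤ 1 := hx
    nlinarith [ht.1, ht.2]
  -- The apex heights have the same sum, `3 + 1 = 2 + 2`.
  have hvol : μ (S (bipyramid ℓ u 1 3 1)) ≤ μ (bipyramid ℓ u 1 2 2) := by
    rw [hS.measure_eq _ hQ]
    refine (measure_bipyramid_le μ hu (by norm_num) one_pos).trans ?_
    have h2u : (2 : ℝ) • u ∈ bipyramid ℓ u 1 2 2 := by
      norm_num [bipyramid, bipyramidGauge, alongProj, hu]
    have := le_measure_of_equator_subset μ hu one_pos (convex_bipyramid zero_le_one)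
      (fun x hx hx' => equator_subset_bipyramid hx hx') h2u (neg_mem_bipyramid h2u)
      (by norm_num [hu])
    refine le_trans (le_of_eq ?_) this
    norm_num [hu]
  -- Up to the factor, `x = (p - q) / 2` and `z = (p + q) / 2` with `p = 3u` the apex and `q = -3/4
  -- u + 1/4 m` on the lower boundary; `2z = p + q` is on the upper boundary. The factor `31/32`
  -- makes `z ± x` interior, yet the gauge of `x` for apexes `±2u` is `31/32 * 17/16 > 1`.
  set x : E := (31 / 32 : ℝ) • ((15 / 8 : ℝ) • u - (1 / 8 : ℝ) • m) with hx'
  have hx : x ∈ S (bipyramid ℓ u 1 3 1) := by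
    refine hS.mem_of_add_sub_mem_interior hQ
      (z := (31 / 32 : ℝ) • ((9 / 8 : ℝ) • u + (1 / 8 : ℝ) • m)) h0 ?_ (hint ?_) (hint ?_)
    · rw [show (31 / 32 : ℝ) • ((9 / 8 : ℝ) • u + (1 / 8 : ℝ) • m) +
        (31 / 32 : ℝ) • ((9 / 8 : ℝ) • u + (1 / 8 : ℝ) • m) =
        (31 / 32 : ℝ) • ((9 / 4 : ℝ) • u + (1 / 4 : ℝ) • m) by module, bipyramid, mem_ofPred_eq,
        bipyramidGauge_smul (by norm_num)]
      norm_num [bipyramidGauge, alongProj, hu, hm, norm_smul, hmn]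
    · rw [show (31 / 32 : ℝ) • ((9 / 8 : ℝ) • u + (1 / 8 : ℝ) • m) + x =
        (31 / 32 : ℝ) • ((3 : ℝ) • u) by rw [hx']; module, bipyramidGauge_smul (by norm_num)]
      norm_num [bipyramidGauge, alongProj, hu, hm, norm_smul, hmn]
    · rw [show (31 / 32 : ℝ) • ((9 / 8 : ℝ) • u + (1 / 8 : ℝ) • m) - x =
        (31 / 32 : ℝ) • ((-3 / 4 : ℝ) • u + (1 / 4 : ℝ) • m) by rw [hx']; module,
        bipyramidGauge_smul (by norm_num)]
      norm_num [bipyramidGauge, alongProj, hu, hm, norm_smul, hmn]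
  have hxX : x ∉ bipyramid ℓ u 1 2 2 := by
    rw [hx', bipyramid, mem_ofPred_eq, bipyramidGauge_smul (by norm_num)]
    norm_num [bipyramidGauge, alongProj, hu, hm, norm_smul, hmn]
  have hcl : IsClosed (bipyramid ℓ u 1 2 2) :=
    isClosed_le continuous_bipyramidGauge continuous_const
  have hne : (interior (S (bipyramid ℓ u 1 3 1))).Nonempty :=
    nonempty_interior_bipyramid.mono (interior_mono hXS)
  -- One point outside has no volume; but `x` is a limit of interior points of `S Q`, so a nonempty
  -- open part of `S Q` lies outside the closed bipyramid.
  have hx2 : x ∈ closure (interior (S (bipyramid ℓ u 1 3 1))) := by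
    rw [(hS.convex _ hQ).closure_interior_eq_closure_of_nonempty_interior hne]
    exact subset_closure hx
  obtain ⟨y, hy1, hy2⟩ := mem_closure_iff.mp hx2 _ hcl.isOpen_compl hxX
  have hpos := ((isOpen_interior (s := S (bipyramid ℓ u 1 3 1))).sdiff hcl).measure_pos μ
    ⟨y, hy2, hy1⟩
  have hadd : μ (interior (S (bipyramid ℓ u 1 3 1)) \ bipyramid ℓ u 1 2 2) +
      μ (bipyramid ℓ u 1 2 2) ≤ μ (bipyramid ℓ u 1 2 2) := by
    rw [← measure_union disjoint_sdiff_left hcl.measurableSet]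
    exact (measure_mono (union_subset (sdiff_subset.trans interior_subset) hXS)).trans hvol
  have hfin : μ (bipyramid ℓ u 1 2 2) ≠ ∞ :=
    (isCompact_bipyramid one_pos two_pos two_pos).measure_ne_top
  exact hpos.ne' (by simpa using ENNReal.le_sub_of_add_le_right hfin hadd)

end CentralSymmetrization

/-! ### Intrinsic volumes: semicontinuity and restriction to a subspace -/

section IntrinsicVolume

open Set Metric Module

/-- The lower integral is continuous from above on arbitrary decreasing sequences. -/
theorem iInf_lintegral_le_lintegral_iInf {α : Type*} [MeasurableSpace α] {μ : Measure α}
    {f : ℕ → α → ℝ≥0∞} (hf : Antitone f) (hfin : ∫⁻ x, f 0 x ∂μ ≠ ∞) :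
    ⨅ k, ∫⁻ x, f k x ∂μ ≤ ∫⁻ x, ⨅ k, f k x ∂μ := by
  choose g hgm hgf hg using fun k => exists_measurable_le_lintegral_eq (μ := μ) (f k)
  -- The measurable minorants `g k` need not decrease. Their tail suprema do, and stay below `f k`
  -- because `f` is antitone.
  let G : ℕ → α → ℝ≥0∞ := fun k x => ⨆ l, g (k + l) x
  have hGm : ∀ k, Measurable (G k) := fun k => Measurable.iSup fun l => hgm _
  have hGf : ∀ k, G k ≤ f k := fun k x =>
    iSup_le fun l => (hgf _ x).trans (hf (Nat.le_add_right k l) x)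
  have hgG : ∀ k, g k ≤ G k := fun k x => le_iSup (fun l => g (k + l) x) 0
  have hGanti : Antitone G := antitone_nat_of_succ_le fun k x =>
    iSup_le fun l => (le_of_eq (by rw [add_assoc])).trans (le_iSup (fun l => g (k + l) x) (1 + l))
  calc ⨅ k, ∫⁻ x, f k x ∂μ ≤ ⨅ k, ∫⁻ x, G k x ∂μ :=
        iInf_mono fun k => (hg k).le.trans (lintegral_mono (hgG k))
    _ = ∫⁻ x, ⨅ k, G k x ∂μ := (lintegral_iInf hGm hGanti
        ((lintegral_mono (hGf 0)).trans_lt hfin.lt_top).ne).symm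
    _ ≤ _ := lintegral_mono fun x => iInf_mono fun k => hGf k x

theorem image_iInter_of_antitone_isCompact {X Y : Type*} [TopologicalSpace X] [TopologicalSpace Y]
    [T2Space X] [T1Space Y] {f : X → Y} (hf : Continuous f) {A : ℕ → Set X} (hA : Antitone A)
    (hc : ∀ k, IsCompact (A k)) : f '' ⋂ k, A k = ⋂ k, f '' A k := by
  refine (image_iInter_subset _ _).antisymm fun y hy => ?_
  have hcl : IsClosed (f ⁻¹' {y}) := isClosed_singleton.preimage hf
  obtain ⟨x, hx⟩ := IsCompact.nonempty_iInter_of_sequence_nonempty_isCompact_isClosed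
    (fun k => A k ∩ f ⁻¹' {y}) (fun k => inter_subset_inter_left _ (hA k.le_succ))
    (fun k => by
      obtain ⟨x, hx, rfl⟩ := mem_iInter.mp hy k
      exact ⟨x, hx, rfl⟩)
    ((hc 0).inter_right hcl) (fun k => (hc k).isClosed.inter hcl)
  rw [mem_iInter] at hx
  exact ⟨x, mem_iInter.mpr fun k => (hx k).1, (hx 0).2⟩

section Linear

variable {E F : Type*} [NormedAddCommGroup E] [InnerProductSpace ℝ E] [FiniteDimensional ℝ E]
  [NormedAddCommGroup F] [InnerProductSpace ℝ F] [FiniteDimensional ℝ F]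

theorem exists_linearIsometryEquiv_of_finrank_eq (h : finrank ℝ E = finrank ℝ F) :
    Nonempty (E ≃ₗᵢ[ℝ] F) :=
  ⟨(stdOrthonormalBasis ℝ E).equiv (stdOrthonormalBasis ℝ F) (finCongr h)⟩

variable [MeasurableSpace E] [BorelSpace E] [MeasurableSpace F] [BorelSpace F]

theorem LinearIsometryEquiv.volume_image (e : E ≃ₗᵢ[ℝ] F) (s : Set E) :
    volume (e '' s) = volume s := by
  rw [← e.measurePreserving.measure_preimage_emb e.toHomeomorph.measurableEmbedding (e '' s),
    e.injective.preimage_image]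

theorem volume_closedBall_eq_of_finrank_eq (h : finrank ℝ E = finrank ℝ F) (r : ℝ) :
    volume (closedBall (0 : E) r) = volume (closedBall (0 : F) r) := by
  obtain ⟨e⟩ := exists_linearIsometryEquiv_of_finrank_eq h
  rw [← LinearIsometryEquiv.volume_image e, e.image_closedBall, map_zero]

theorem exists_volume_image_eq_mul (h : finrank ℝ E = finrank ℝ F) (T : E →ₗ[ℝ] F) :
    ∃ d : ℝ≥0∞, ∀ s : Set E, volume (T '' s) = d * volume s := by
  obtain ⟨e⟩ := exists_linearIsometryEquiv_of_finrank_eq h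
  refine ⟨ENNReal.ofReal |LinearMap.det ((e.symm.toLinearEquiv : F →ₗ[ℝ] E) ∘ₗ T)|, fun s => ?_⟩
  rw [← Measure.addHaar_image_linearMap, ← LinearIsometryEquiv.volume_image e.symm, image_image]
  rfl

end Linear

variable {n j : ℕ}

instance isProbabilityMeasure_orthogonalHaar (n : ℕ) : IsProbabilityMeasure (orthogonalHaar n) :=
  ⟨by
    have := Measure.haarMeasure_self (K₀ := (⊤ : TopologicalSpace.PositiveCompacts
      (OrthogonalOperators n)))
    rwa [TopologicalSpace.PositiveCompacts.coe_top] at this⟩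

instance isOpenPosMeasure_orthogonalHaar (n : ℕ) : (orthogonalHaar n).IsOpenPosMeasure := by
  unfold orthogonalHaar; infer_instance

theorem grassmannianHaar_univ (h : j ≤ n) : grassmannianHaar n j univ = 1 := by
  rw [grassmannianHaar, dif_pos h,
    Measure.map_apply (RealGrassmannian.continuous_rotate _).measurable MeasurableSet.univ]
  simp

/-- An isometry from `E` onto `F` extends to an isometry of the whole space. -/
theorem RealGrassmannian.exists_rotate_eq (E F : RealGrassmannian n j) :
    ∃ g : OrthogonalOperators n, E.rotate g = F := by
  obtain ⟨e⟩ := exists_linearIsometryEquiv_of_finrank_eq (E := E.1) (F := F.1) (E.2.trans F.2.symm)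
  let L : E.1 →ₗᵢ[ℝ] EuclideanSpace ℝ (Fin n) := F.1.subtypeₗᵢ.comp e.toLinearIsometry
  let g := L.extend.toLinearIsometryEquiv rfl
  have hg : ∀ x : E.1, g x = e x := fun x => L.extend_apply x
  refine ⟨Unitary.linearIsometryEquiv.symm g, Subtype.ext ?_⟩
  simp only [RealGrassmannian.rotate, MulEquiv.apply_symm_apply]
  ext y
  constructor
  · rintro ⟨x, hx, rfl⟩
    have : g x ∈ F.1 := by rw [hg ⟨x, hx⟩]; exact (e _).2
    exact this
  · intro hy
    refine ⟨e.symm ⟨y, hy⟩, (e.symm ⟨y, hy⟩).2, ?_⟩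
    have := hg (e.symm ⟨y, hy⟩)
    rw [e.apply_symm_apply] at this
    exact this

theorem grassmannianHaar_pos_of_isOpen (h : j ≤ n) {U : Set (RealGrassmannian n j)}
    (hU : IsOpen U) {E : RealGrassmannian n j} (hE : E ∈ U) : 0 < grassmannianHaar n j U := by
  have hc := RealGrassmannian.continuous_rotate (RealGrassmannian.base h)
  rw [grassmannianHaar, dif_pos h, Measure.map_apply hc.measurable hU.measurableSet]
  obtain ⟨g, hg⟩ := RealGrassmannian.exists_rotate_eq (RealGrassmannian.base h) E
  exact (hU.preimage hc).measure_pos _ ⟨g, by rwa [mem_preimage, hg]⟩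

theorem unitBallVolume_ne_zero (m : ℕ) : unitBallVolume m ≠ 0 :=
  (measure_closedBall_pos _ _ one_pos).ne'

theorem unitBallVolume_ne_top (m : ℕ) : unitBallVolume m ≠ ∞ :=
  (isCompact_closedBall _ _).measure_ne_top

theorem kubotaConstant_ne_zero (h : j ≤ n) :
    n.choose j * unitBallVolume n / (unitBallVolume j * unitBallVolume (n - j)) ≠ 0 :=
  (ENNReal.div_pos (mul_ne_zero (by exact_mod_cast (Nat.choose_pos h).ne')
    (unitBallVolume_ne_zero n))
    (ENNReal.mul_ne_top (unitBallVolume_ne_top _) (unitBallVolume_ne_top _))).ne'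

theorem kubotaConstant_ne_top :
    n.choose j * unitBallVolume n / (unitBallVolume j * unitBallVolume (n - j)) ≠ ∞ :=
  ENNReal.div_ne_top (ENNReal.mul_ne_top (ENNReal.natCast_ne_top _) (unitBallVolume_ne_top _))
    (mul_ne_zero (unitBallVolume_ne_zero _) (unitBallVolume_ne_zero _))

theorem intrinsicVolume_mono {K L : Set (EuclideanSpace ℝ (Fin n))} (h : K ⊆ L) :
    intrinsicVolume n j K ≤ intrinsicVolume n j L := by
  unfold intrinsicVolume
  gcongr
  exact image_mono h

theorem volume_projOnto_le {K : Set (EuclideanSpace ℝ (Fin n))} {R : ℝ}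
    (hK : K ⊆ closedBall 0 R) (F : RealGrassmannian n j) :
    volume (projOnto K F.1) ≤ volume (closedBall (0 : EuclideanSpace ℝ (Fin j)) R) := by
  rw [← volume_closedBall_eq_of_finrank_eq (E := F.1) (by rw [F.2]; simp)]
  refine measure_mono ?_
  rintro _ ⟨x, hx, rfl⟩
  rw [mem_closedBall_zero_iff]
  exact (F.1.norm_orthogonalProjectionOnto_apply_le x).trans (mem_closedBall_zero_iff.mp (hK hx))

theorem lintegral_volume_projOnto_ne_top (h : j ≤ n) {K : Set (EuclideanSpace ℝ (Fin n))}
    (hK : Bornology.IsBounded K) :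
    ∫⁻ F : RealGrassmannian n j, volume (projOnto K F.1) ∂grassmannianHaar n j ≠ ∞ := by
  obtain ⟨R, hR⟩ := hK.subset_closedBall 0
  refine ((lintegral_mono fun F => volume_projOnto_le hR F).trans_lt ?_).ne
  rw [lintegral_const, grassmannianHaar_univ h, mul_one]
  exact (isCompact_closedBall _ _).measure_lt_top

/-- By compactness, projections commute with the decreasing intersection, so the integrands converge
pointwise. Working with lower integrals avoids any measurability of the integrand. -/
theorem iInf_intrinsicVolume_le (h : j ≤ n) {A : ℕ → Set (EuclideanSpace ℝ (Fin n))}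
    (hA : Antitone A) (hc : ∀ k, IsCompact (A k)) :
    ⨅ k, intrinsicVolume n j (A k) ≤ intrinsicVolume n j (⋂ k, A k) := by
  have hvol : ∀ F : RealGrassmannian n j,
      volume (projOnto (⋂ k, A k) F.1) = ⨅ k, volume (projOnto (A k) F.1) := by
    intro F
    have hcont := F.1.orthogonalProjectionOnto.continuous
    have hanti : Antitone fun k => projOnto (A k) F.1 := fun k l hkl => image_mono (hA hkl)
    have hcomp : ∀ k, IsCompact (projOnto (A k) F.1) := fun k => (hc k).image hcont
    rw [← hanti.measure_iInter (fun k => (hcomp k).measurableSet.nullMeasurableSet)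
      ⟨0, (hcomp 0).measure_ne_top⟩]
    exact congrArg _ (image_iInter_of_antitone_isCompact hcont hA hc)
  unfold intrinsicVolume
  rw [← ENNReal.mul_iInf_of_ne (kubotaConstant_ne_zero h) kubotaConstant_ne_top]
  gcongr
  simp only [hvol]
  exact iInf_lintegral_le_lintegral_iInf
    (fun k l hkl F => measure_mono (image_mono (hA hkl)))
    (lintegral_volume_projOnto_ne_top h (hc 0).isBounded)

theorem half_norm_le_norm_orthogonalProjectionOnto {E F : Submodule ℝ (EuclideanSpace ℝ (Fin n))}
    (h : ‖F.starProjection - E.starProjection‖ < 1 / 2) (x : E) :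
    ‖x‖ / 2 ≤ ‖F.orthogonalProjectionOnto x‖ := by
  have h1 := (F.starProjection - E.starProjection).le_of_opNorm_le h.le (x : EuclideanSpace ℝ (Fin n))
  rw [sub_apply, Submodule.starProjection_eq_self_iff.mpr x.2] at h1
  have h2 := norm_sub_norm_le (x : EuclideanSpace ℝ (Fin n)) (F.starProjection x)
  rw [norm_sub_rev] at h2
  have h3 : ‖F.starProjection (x : EuclideanSpace ℝ (Fin n))‖ = ‖F.orthogonalProjectionOnto x‖ := rfl
  have h4 : ‖(x : EuclideanSpace ℝ (Fin n))‖ = ‖x‖ := rfl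
  linarith

/-- On the subsets of a `j`-dimensional subspace `E`, the `j`-th intrinsic volume is a positive
multiple of the Lebesgue measure of `E`. -/
theorem exists_intrinsicVolume_eq_mul_volume (E : RealGrassmannian n j) :
    ∃ c : ℝ≥0∞, c ≠ 0 ∧ c ≠ ∞ ∧ ∀ A : Set E.1, volume A ≠ ∞ →
      intrinsicVolume n j ((↑) '' A) = c * volume A := by
  have hjn : j ≤ n := by
    have := E.1.finrank_le
    rwa [E.2, finrank_euclideanSpace_fin] at this
  let T : ∀ F : RealGrassmannian n j, E.1 →ₗ[ℝ] F.1 := fun F =>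
    (F.1.orthogonalProjectionOnto : EuclideanSpace ℝ (Fin n) →ₗ[ℝ] F.1) ∘ₗ E.1.subtype
  choose d hd using fun F : RealGrassmannian n j =>
    exists_volume_image_eq_mul (E.2.trans F.2.symm) (T F)
  have hT : ∀ (F : RealGrassmannian n j) (A : Set E.1), projOnto ((↑) '' A) F.1 = T F '' A := by
    intro F A
    rw [projOnto, image_image]; rfl
  set B := closedBall (0 : E.1) 1 with hB
  have hB0 : volume B ≠ 0 := (measure_closedBall_pos _ _ one_pos).ne'
  have hBtop : volume B ≠ ∞ := (isCompact_closedBall _ _).measure_ne_top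
  -- `d F` is the factor by which projection of `E` to `F` scales volume. It is at most `1` by
  -- contraction, and at least `δ` for `F` near `E`, where norms are at most halved; hence its
  -- integral is finite and positive.
  have hd1 : ∀ F, d F ≤ 1 := by
    intro F
    have h1 : volume (T F '' B) ≤ 1 * volume B := by
      rw [one_mul, hB, volume_closedBall_eq_of_finrank_eq (E.2.trans F.2.symm)]
      refine measure_mono ?_
      rintro _ ⟨x, hx, rfl⟩
      rw [mem_closedBall_zero_iff] at *
      exact (F.1.norm_orthogonalProjectionOnto_apply_le _).trans hx
    rw [hd] at h1
    exact (ENNReal.mul_le_mul_iff_left hB0 hBtop).mp h1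
  set δ := volume (closedBall (0 : E.1) (1 / 2)) / volume B with hδ
  have hδ0 : 0 < δ := ENNReal.div_pos (measure_closedBall_pos _ _ (by norm_num)).ne' hBtop
  set U := {F : RealGrassmannian n j | ‖F.1.starProjection - E.1.starProjection‖ < 1 / 2} with hU
  have hUo : IsOpen U := by
    have : Continuous fun F : RealGrassmannian n j => F.1.starProjection :=
      continuous_induced_dom
    exact isOpen_lt (this.sub continuous_const).norm continuous_const
  have hEU : E ∈ U := by simp [hU]
  have hdU : ∀ F ∈ U, δ ≤ d F := by
    intro F hF
    have hinj : Function.Injective (T F) := by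
      rw [← LinearMap.ker_eq_bot, LinearMap.ker_eq_bot']
      intro x hx
      have := half_norm_le_norm_orthogonalProjectionOnto hF x
      have hx : F.1.orthogonalProjectionOnto (x : EuclideanSpace ℝ (Fin n)) = 0 := hx
      rw [hx, norm_zero] at this
      exact norm_le_zero_iff.mp (by linarith)
    have hsurj : Function.Surjective (T F) :=
      (LinearMap.injective_iff_surjective_of_finrank_eq_finrank (E.2.trans F.2.symm)).mp hinj
    rw [hδ, ENNReal.div_le_iff hB0 hBtop, ← hd,
      volume_closedBall_eq_of_finrank_eq (E.2.trans F.2.symm)]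
    refine measure_mono fun y hy => ?_
    obtain ⟨x, rfl⟩ := hsurj y
    refine mem_image_of_mem _ ?_
    have := half_norm_le_norm_orthogonalProjectionOnto hF x
    rw [mem_closedBall_zero_iff] at *
    have hy : ‖F.1.orthogonalProjectionOnto (x : EuclideanSpace ℝ (Fin n))‖ ≤ 1 / 2 := hy
    linarith
  have hI0 : ∫⁻ F, d F ∂grassmannianHaar n j ≠ 0 := by
    have h1 : δ * grassmannianHaar n j U ≤ ∫⁻ F, d F ∂grassmannianHaar n j := by
      rw [← lintegral_indicator_const hUo.measurableSet]
      refine lintegral_mono fun F => ?_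
      by_cases hF : F ∈ U
      · simpa [hF] using hdU F hF
      · simp [hF]
    exact ((ENNReal.mul_pos hδ0.ne' (grassmannianHaar_pos_of_isOpen hjn hUo hEU).ne').trans_le
      h1).ne'
  have hItop : ∫⁻ F, d F ∂grassmannianHaar n j ≠ ∞ := by
    refine ((lintegral_mono hd1).trans_lt ?_).ne
    simp [grassmannianHaar_univ hjn]
  refine ⟨_, mul_ne_zero (kubotaConstant_ne_zero hjn) hI0,
    ENNReal.mul_ne_top kubotaConstant_ne_top hItop, fun A hA => ?_⟩
  simp only [intrinsicVolume, hT, hd]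
  rw [lintegral_mul_const' _ _ hA, mul_assoc]

end IntrinsicVolume

/-! ### Restricting a symmetrization to a subspace orthogonal to `H` -/

section Restriction

open Set Metric Module

variable {n : ℕ}

/-- The `k`-th member of a sequence of bodies of `ℝⁿ` decreasing to a subset of a subspace. -/
noncomputable def outerParallelSet {E : Submodule ℝ (EuclideanSpace ℝ (Fin n))} (K : Set E)
    (k : ℕ) : Set (EuclideanSpace ℝ (Fin n)) :=
  cthickening (1 / (k + 1)) ((↑) '' K)

section OuterParallelSet

variable {E : Submodule ℝ (EuclideanSpace ℝ (Fin n))} {K : Set E}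

theorem antitone_outerParallelSet : Antitone (outerParallelSet K) := fun _ _ hkl =>
  cthickening_mono (Nat.one_div_le_one_div hkl) _

theorem subset_interior_outerParallelSet (k : ℕ) :
    (↑) '' K ⊆ interior (outerParallelSet K k) :=
  (self_subset_thickening Nat.one_div_pos_of_nat _).trans
    (interior_maximal (thickening_subset_cthickening _ _) isOpen_thickening)

theorem isBody_outerParallelSet (hK : IsCompact K) (hconv : Convex ℝ K) (hne : K.Nonempty)
    (k : ℕ) : IsBody (outerParallelSet K k) :=
  ⟨(hK.image continuous_subtype_val).cthickening, (hconv.linear_image E.subtype).cthickening _,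
    (hne.image _).mono (subset_interior_outerParallelSet k)⟩

theorem exists_outerParallelSet_subset (hK : IsCompact K) {L : Set (EuclideanSpace ℝ (Fin n))}
    (h : (↑) '' K ⊆ interior L) : ∃ k, outerParallelSet K k ⊆ L := by
  obtain ⟨δ, hδ, hsub⟩ := (hK.image continuous_subtype_val).exists_cthickening_subset_open
    isOpen_interior h
  obtain ⟨k, hk⟩ := exists_nat_one_div_lt hδ
  exact ⟨k, (cthickening_mono hk.le _).trans (hsub.trans interior_subset)⟩

theorem iInter_outerParallelSet (hK : IsCompact K) :
    ⋂ k, outerParallelSet K k = (↑) '' K := by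
  have hc : IsClosed ((↑) '' K : Set (EuclideanSpace ℝ (Fin n))) :=
    (hK.image continuous_subtype_val).isClosed
  refine (subset_iInter fun k => self_subset_cthickening _).antisymm' fun x hx => ?_
  rw [← hc.closure_eq, closure_eq_iInter_cthickening, mem_iInter₂]
  intro δ hδ
  obtain ⟨k, hk⟩ := exists_nat_one_div_lt hδ
  exact cthickening_mono hk.le _ (mem_iInter.mp hx k)

/-- The reflection is an isometry acting as `-1` on `E`, so it preserves `K` and distances to `K`.
-/
theorem isSymmetricAbout_outerParallelSet {H : Submodule ℝ (EuclideanSpace ℝ (Fin n))}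
    (hE : E ≤ Hᗮ) (hsymm : ∀ x ∈ K, -x ∈ K) (k : ℕ) :
    IsSymmetricAbout H (outerParallelSet K k) := by
  have himage : H.reflection '' ((↑) '' K) = ((↑) '' K : Set (EuclideanSpace ℝ (Fin n))) := by
    have hrefl : ∀ x : E, H.reflection (x : EuclideanSpace ℝ (Fin n)) = (-x : E) := fun x =>
      Submodule.reflection_mem_subspace_orthogonalComplement_eq_neg (hE x.2)
    ext y
    constructor
    · rintro ⟨_, ⟨x, hx, rfl⟩, rfl⟩
      exact ⟨-x, hsymm x hx, (hrefl x).symm⟩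
    · rintro ⟨x, hx, rfl⟩
      exact ⟨_, ⟨-x, hsymm x hx, rfl⟩, by rw [hrefl, neg_neg]⟩
  have hmem : ∀ x, x ∈ outerParallelSet K k → H.reflection x ∈ outerParallelSet K k := by
    intro x hx
    rw [outerParallelSet, mem_cthickening_iff] at *
    rwa [← himage, infEDist_image H.reflection.isometry]
  refine Subset.antisymm ?_ fun x hx => ⟨_, hmem x hx, Submodule.reflection_reflection H x⟩
  rintro _ ⟨x, hx, rfl⟩
  exact hmem x hx

end OuterParallelSet

namespace Symmetrization

variable {𝓑 : Set (Set (EuclideanSpace ℝ (Fin n)))} {H : Submodule ℝ (EuclideanSpace ℝ (Fin n))}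

/-- The operator induced on the subsets of a subspace: `K` is approximated from outside by members
of `𝓑`. -/
def restrict (S : Symmetrization 𝓑 H) (E : Submodule ℝ (EuclideanSpace ℝ (Fin n))) (K : Set E) :
    Set E :=
  {x | ∀ L : 𝓑, (↑) '' K ⊆ interior (L : Set (EuclideanSpace ℝ (Fin n))) →
    (x : EuclideanSpace ℝ (Fin n)) ∈ (S L : Set (EuclideanSpace ℝ (Fin n)))}

variable {S : Symmetrization 𝓑 H} {E : Submodule ℝ (EuclideanSpace ℝ (Fin n))} {K : Set E}

theorem outerParallelSet_mem (hmem : ∀ L, IsBody L → L ∈ 𝓑) (hK : IsBody K) (k : ℕ) :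
    outerParallelSet K k ∈ 𝓑 :=
  hmem _ (isBody_outerParallelSet hK.isCompact hK.convex
    (hK.nonempty_interior.mono interior_subset) k)

theorem iInter_outerParallelSet_of_neg_mem (hmem : ∀ L, IsBody L → L ∈ 𝓑) (hE : E ≤ Hᗮ)
    (hinv : S.IsInvariantOnSymmetric) (hK : IsBody K) (hsymm : ∀ x ∈ K, -x ∈ K) :
    ⋂ k, (S ⟨outerParallelSet K k, outerParallelSet_mem hmem hK k⟩ :
      Set (EuclideanSpace ℝ (Fin n))) = (↑) '' K := by
  rw [← iInter_outerParallelSet hK.isCompact]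
  exact iInter_congr fun k => hinv _ (isSymmetricAbout_outerParallelSet hE hsymm k)

theorem image_restrict (hmem : ∀ L, IsBody L → L ∈ 𝓑) (hE : E ≤ Hᗮ) (hmono : S.IsMonotonic)
    (hinv : S.IsInvariantOnSymmetric) (hK : IsBody K) :
    (↑) '' S.restrict E K = ⋂ k, (S ⟨outerParallelSet K k, outerParallelSet_mem hmem hK k⟩ :
      Set (EuclideanSpace ℝ (Fin n))) := by
  apply Subset.antisymm
  · rintro _ ⟨x, hx, rfl⟩
    exact mem_iInter.mpr fun k => hx ⟨_, outerParallelSet_mem hmem hK k⟩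
      (subset_interior_outerParallelSet k)
  · intro y hy
    rw [mem_iInter] at hy
    -- A centred ball of `E` containing `K` forces the intersection into `E`: its parallel sets are
    -- fixed by `S` and shrink back to the ball.
    obtain ⟨R, hR0, hR⟩ := hK.isCompact.isBounded.subset_closedBall_lt 0 0
    have hB : IsBody (closedBall (0 : E) R) := ⟨isCompact_closedBall _ _, convex_closedBall _ _,
      ⟨0, ball_subset_interior_closedBall (mem_ball_self hR0)⟩⟩
    have hyB : y ∈ ((↑) '' closedBall (0 : E) R : Set (EuclideanSpace ℝ (Fin n))) := by
      rw [← iInter_outerParallelSet_of_neg_mem hmem hE hinv hB (by simp), mem_iInter]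
      exact fun k => hmono _ _ (cthickening_subset_of_subset _ (image_mono hR)) (hy k)
    obtain ⟨x, -, rfl⟩ := hyB
    refine ⟨x, fun L hL => ?_, rfl⟩
    obtain ⟨k, hk⟩ := exists_outerParallelSet_subset hK.isCompact hL
    exact hmono ⟨_, outerParallelSet_mem hmem hK k⟩ L hk (hy k)

theorem isCentralSymmetrization_restrict {j : ℕ} (hmem : ∀ L, IsBody L → L ∈ 𝓑)
    (hcc : 𝓑 ⊆ compactConvexSets n) (hE : E ≤ Hᗮ) (hEj : finrank ℝ E = j)
    (hmono : S.IsMonotonic) (hinv : S.IsInvariantOnSymmetric)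
    (hpres : S.IsPreserving (intrinsicVolume n j)) :
    IsCentralSymmetrization volume (S.restrict E) := by
  have hcompact : ∀ K : Set E, IsBody K → IsCompact (S.restrict E K) := by
    intro K hK
    refine Topology.IsInducing.subtypeVal.isCompact_iff.mpr ?_
    have hk := fun k => (hcc (S ⟨outerParallelSet K k, outerParallelSet_mem hmem hK k⟩).2.1).1
    have := (hk 0).of_isClosed_subset (isClosed_iInter fun k => (hk k).isClosed)
      (iInter_subset _ 0)
    rwa [← image_restrict hmem hE hmono hinv hK] at this
  refine ⟨hcompact, ?_, ?_, ?_, ?_, ?_⟩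
  · intro K hK x hx y hy s t hs ht hst L hL
    exact (hcc (S L).2.1).2 (hx L hL) (hy L hL) hs ht hst
  · intro K hK x hx L hL
    have hsymm : H.reflection '' (S L : Set (EuclideanSpace ℝ (Fin n))) = S L := (S L).2.2
    have := mem_image_of_mem H.reflection (hx L hL)
    rwa [hsymm, Submodule.reflection_mem_subspace_orthogonalComplement_eq_neg (hE x.2)] at this
  · exact fun K L _ _ hKL x hx M hM => hx M ((image_mono hKL).trans hM)
  · intro K hK hsymm
    apply Subtype.val_injective.image_injective
    exact (image_restrict hmem hE hmono hinv hK).trans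
      (iInter_outerParallelSet_of_neg_mem hmem hE hinv hK hsymm)
  · intro K hK
    obtain ⟨c, hc0, hctop, hc⟩ := exists_intrinsicVolume_eq_mul_volume
      (⟨E, hEj⟩ : RealGrassmannian n j)
    have hjn : j ≤ n := by
      have := E.finrank_le
      rwa [hEj, finrank_euclideanSpace_fin] at this
    rw [← ENNReal.mul_right_inj hc0 hctop, ← hc _ (hcompact K hK).measure_ne_top,
      ← hc _ hK.isCompact.measure_ne_top]
    have hvol : ∀ k, intrinsicVolume n j
        (S ⟨outerParallelSet K k, outerParallelSet_mem hmem hK k⟩) =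
          intrinsicVolume n j (outerParallelSet K k) := fun k => hpres _
    rw [image_restrict hmem hE hmono hinv hK]
    -- Both sides equal the infimum of `V_j` over the parallel sets, by monotonicity, semicontinuity
    -- and preservation of `V_j`.
    apply le_antisymm
    · calc _ ≤ ⨅ k, intrinsicVolume n j (outerParallelSet K k) :=
            le_iInf fun k => (intrinsicVolume_mono (iInter_subset _ k)).trans (hvol k).le
        _ ≤ intrinsicVolume n j (⋂ k, outerParallelSet K k) :=
            iInf_intrinsicVolume_le hjn antitone_outerParallelSet
              fun k => (hcc (outerParallelSet_mem hmem hK k)).1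
        _ = _ := by rw [iInter_outerParallelSet hK.isCompact]
    · refine le_trans (le_iInf fun k => ?_) (iInf_intrinsicVolume_le hjn
        (fun k l hkl => hmono _ _ (antitone_outerParallelSet hkl)) fun k => (hcc (S _).2.1).1)
      rw [hvol]
      exact intrinsicVolume_mono (self_subset_cthickening _)

end Symmetrization

theorem exists_le_finrank_eq {V : Type*} [AddCommGroup V] [Module ℝ V] [FiniteDimensional ℝ V]
    {W : Submodule ℝ V} {j : ℕ} (hj : j ≤ finrank ℝ W) : ∃ E ≤ W, finrank ℝ E = j := by
  obtain ⟨f, hf⟩ := exists_linearIndependent_of_le_finrank hj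
  refine ⟨(Submodule.span ℝ (range f)).map W.subtype, Submodule.map_subtype_le _ _, ?_⟩
  rw [Submodule.finrank_map_subtype_eq, finrank_span_eq_card hf, Fintype.card_fin]

end Restriction

theorem theorem4p1 (n i j : ℕ) (hi : i < n) (hj₂ : 2 ≤ j) (hjn : j ≤ n) (hij : i + j ≤ n)
    (H : Submodule ℝ (EuclideanSpace ℝ (Fin n))) (hH : Module.finrank ℝ H = i)
    (𝓑 : Set (Set (EuclideanSpace ℝ (Fin n))))
    (h𝓑 : 𝓑 = compactConvexSets n ∨ 𝓑 = convexBodies n) :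
    ¬ ∃ S : Symmetrization 𝓑 H,
      S.IsMonotonic ∧ S.IsInvariantOnSymmetric ∧ S.IsPreserving (intrinsicVolume n j) := by
  rintro ⟨S, hmono, hinv, hpres⟩
  have hmem : ∀ L, IsBody L → L ∈ 𝓑 := by
    rcases h𝓑 with rfl | rfl
    · exact fun L hL => ⟨hL.isCompact, hL.convex⟩
    · exact fun L hL => ⟨hL.isCompact, hL.convex, hL.nonempty_interior⟩
  have hcc : 𝓑 ⊆ compactConvexSets n := by
    rcases h𝓑 with rfl | rfl
    · exact subset_rfl
    · exact fun L hL => ⟨hL.1, hL.2.1⟩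
  have hdim := H.finrank_add_finrank_orthogonal
  rw [hH, finrank_euclideanSpace_fin] at hdim
  obtain ⟨E, hE, hEj⟩ := exists_le_finrank_eq (W := Hᗮ) (j := j) (by omega)
  exact not_isCentralSymmetrization volume (hj₂.trans_eq hEj.symm) (S.restrict E)
    (Symmetrization.isCentralSymmetrization_restrict hmem hcc hE hEj hmono hinv hpres)
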